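/- Let $\mathbb{F}$ be an algebraically closed field of arbitrary characteristic. For integers $d,n\ge 0$ let $C(d,n)$ be the set of all $d$-tuples $(A_1,\dots,A_d)$ of pairwise commuting $n\times n$ matrices over $\mathbb{F}$, and let $N(d,n)\subseteq C(d,n)$ be the subset of those $d$-tuples in which every $A_i$ is nilpotent. Both are regarded as subsets (affine varieties) of the affine space $\mathbb{F}^{dn^2}$ with the Zariski topology, and irreducibility is meant in this topology. Then: (1) If $C(d,m)$ is irreducible for every $m$ with $0<m<n$ and $N(d,n)$ is irreducible, then $C(d,n)$ is irreducible. (2) If $N(d,m)$ is irreducible for every $m$ with $0<m\le n$, then $C(d,n)$ is irreducible. -/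

import Mathlib

/-- The Zariski topology on the affine space `K^σ`: the closed sets are the common zero loci
of ideals of `K[x_s : s ∈ σ]`. -/
@[reducible] def zariskiTopology (σ K : Type*) [Field K] : TopologicalSpace (σ → K) :=
  TopologicalSpace.ofClosed
    {Z | ∃ I : Ideal (MvPolynomial σ K), Z = MvPolynomial.zeroLocus K I}
    ⟨⊤, by ext x; simp⟩
    (by
      intro T hT
      refine ⟨⨆ Z ∈ T, MvPolynomial.vanishingIdeal K Z, ?_⟩
      apply Set.Subset.antisymm
      · have h : (⨆ Z ∈ T, MvPolynomial.vanishingIdeal K Z)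
            ≤ MvPolynomial.vanishingIdeal K (⋂₀ T) :=
          iSup₂_le fun Z hZ =>
            MvPolynomial.vanishingIdeal_anti_mono (Set.sInter_subset_of_mem hZ)
        exact fun x hx p hp => h hp x hx
      · intro x hx Z hZ
        obtain ⟨I, rfl⟩ := hT hZ
        intro p hp
        apply hx p
        have h : MvPolynomial.vanishingIdeal K (MvPolynomial.zeroLocus K I)
            ≤ ⨆ Z ∈ T, MvPolynomial.vanishingIdeal K Z :=
          le_iSup₂_of_le (MvPolynomial.zeroLocus K I) hZ le_rfl
        exact h (MvPolynomial.le_vanishingIdeal_zeroLocus I hp))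
    (by
      rintro _ ⟨I, rfl⟩ _ ⟨J, rfl⟩
      refine ⟨I * J, ?_⟩
      apply Set.Subset.antisymm
      · rintro x (hx | hx)
        · exact MvPolynomial.zeroLocus_anti_mono Ideal.mul_le_left hx
        · exact MvPolynomial.zeroLocus_anti_mono Ideal.mul_le_right hx
      · intro x hx
        by_contra hcon
        simp only [Set.mem_union, MvPolynomial.mem_zeroLocus_iff, not_or, not_forall] at hcon
        obtain ⟨⟨p, hp, hpx⟩, q, hq, hqx⟩ := hcon
        have := hx (p * q) (Ideal.mul_mem_mul hp hq)
        rw [map_mul] at this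
        exact (mul_ne_zero hpx hqx) this)

/-- `d`-tuples of `n × n` matrices over `F`. -/
abbrev MatrixTuple (F : Type*) (d n : ℕ) : Type _ :=
  Fin d → Matrix (Fin n) (Fin n) F

/-- All the entries of all the matrices of a tuple: the identification of the set of `d`-tuples
of `n × n` matrices with the affine space `F^(d n²)`. -/
def MatrixTuple.coords {F : Type*} {d n : ℕ} (A : MatrixTuple F d n) :
    Fin d × Fin n × Fin n → F :=
  fun t => A t.1 t.2.1 t.2.2

/-- The Zariski topology on `d`-tuples of `n × n` matrices, that is, on `F^(d n²)`. -/
@[reducible] def MatrixTuple.zariski (F : Type*) [Field F] (d n : ℕ) : TopologicalSpace (MatrixTuple F d n) :=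
  (zariskiTopology (Fin d × Fin n × Fin n) F).induced MatrixTuple.coords

/-- Irreducibility of a set of matrix tuples in the Zariski topology: it is nonempty and is not
the union of two proper relatively closed subsets. -/
def MatrixTuple.IsZariskiIrreducible {F : Type*} [Field F] {d n : ℕ}
    (S : Set (MatrixTuple F d n)) : Prop :=
  @IsIrreducible (MatrixTuple F d n) (MatrixTuple.zariski F d n) S

/-- `C(d, n)`: the `d`-tuples of pairwise commuting `n × n` matrices. -/
def commutingVariety (F : Type*) [Field F] (d n : ℕ) : Set (MatrixTuple F d n) :=
  {A | ∀ i j, Commute (A i) (A j)}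

/-- `N(d, n)`: the `d`-tuples of pairwise commuting nilpotent `n × n` matrices. -/
def nilpotentCommutingVariety (F : Type*) [Field F] (d n : ℕ) : Set (MatrixTuple F d n) :=
  {A | (∀ i j, Commute (A i) (A j)) ∧ ∀ i, IsNilpotent (A i)}

/-! Tuples diagonal in a common basis form an irreducible set G, the image of an open subset of an
affine space, and G lies in C(d,n). So C(d,n) is irreducible as soon as it lies in the closure of G.

The main tool is `subset_closure_of_shiftTuple_mem`. In an irreducible set of commuting tuples
containing (J, 0, …, 0), the tuples whose first matrix has the first basis vector as a cyclic vector
form a nonempty open, hence dense, subset. On it every matrix is a polynomial in the first one, and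
diagonalizable matrices are dense, so these tuples lie in the closure of G. This covers both C(d,m)
for m < n and N(d,n).

An arbitrary commuting tuple is then reduced to these cases. If each matrix has a single eigenvalue,
the tuple is a scalar translate of a nilpotent one (`add_scalar_mem_closure`). Otherwise a Fitting
decomposition splits it into smaller commuting tuples (`exists_fromBlocks_of_isCompl`,
`fromBlocks_mem_closure`). Part (2) iterates part (1). -/

open Matrix

attribute [local instance] MatrixTuple.zariski

namespace MatrixTuple

variable {F : Type*} [Field F] {d n d' n' : ℕ}

/-! ### Polynomial functions and the Zariski topology on tuples -/

/-- The algebra of polynomial functions on the space of matrix tuples. -/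
def regularFunctions (F : Type*) [Field F] (d n : ℕ) : Subalgebra F (MatrixTuple F d n → F) :=
  Algebra.adjoin F (Set.range fun (t : Fin d × Fin n × Fin n) (A : MatrixTuple F d n) => A.coords t)

theorem entry_mem_regularFunctions (i : Fin d) (a b : Fin n) :
    (fun A : MatrixTuple F d n => A i a b) ∈ regularFunctions F d n :=
  Algebra.subset_adjoin ⟨(i, a, b), rfl⟩

theorem const_mem_regularFunctions (c : F) :
    (fun _ : MatrixTuple F d n => c) ∈ regularFunctions F d n :=
  (regularFunctions F d n).algebraMap_mem c

theorem mem_regularFunctions_iff {f : MatrixTuple F d n → F} :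
    f ∈ regularFunctions F d n ↔
      ∃ p : MvPolynomial (Fin d × Fin n × Fin n) F, ∀ A, f A = MvPolynomial.aeval A.coords p := by
  have key : ∀ (p : MvPolynomial (Fin d × Fin n × Fin n) F) (A : MatrixTuple F d n),
      MvPolynomial.aeval (fun (t : Fin d × Fin n × Fin n) (A : MatrixTuple F d n) => A.coords t) p A
        = MvPolynomial.aeval A.coords p := by
    intro p A
    have := MvPolynomial.comp_aeval_apply
      (fun (t : Fin d × Fin n × Fin n) (A : MatrixTuple F d n) => A.coords t)
      (Pi.evalAlgHom F (fun _ : MatrixTuple F d n => F) A) p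
    simpa using this
  rw [regularFunctions, Algebra.adjoin_range_eq_range_aeval]
  constructor
  · rintro ⟨p, rfl⟩
    exact ⟨p, fun A => key p A⟩
  · rintro ⟨p, hp⟩
    exact ⟨p, funext fun A => (key p A).trans (hp A).symm⟩

theorem isClosed_iff {Z : Set (MatrixTuple F d n)} :
    IsClosed Z ↔ ∃ I : Ideal (MvPolynomial (Fin d × Fin n × Fin n) F),
      Z = MatrixTuple.coords ⁻¹' MvPolynomial.zeroLocus F I := by
  let _ := zariskiTopology (Fin d × Fin n × Fin n) F
  rw [isClosed_induced_iff]
  constructor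
  · rintro ⟨t, ht, rfl⟩
    obtain ⟨I, hI⟩ := isOpen_compl_iff.2 ht
    exact ⟨I, by rw [← hI, compl_compl]⟩
  · rintro ⟨I, rfl⟩
    exact ⟨MvPolynomial.zeroLocus F I, ⟨⟨I, compl_compl _⟩⟩, rfl⟩

theorem isClosed_regular_eq_zero {f : MatrixTuple F d n → F} (hf : f ∈ regularFunctions F d n) :
    IsClosed {A | f A = 0} := by
  obtain ⟨p, hp⟩ := mem_regularFunctions_iff.1 hf
  refine isClosed_iff.2 ⟨Ideal.span {p}, ?_⟩
  ext A
  simp only [Set.mem_ofPred_eq, Set.mem_preimage, MvPolynomial.mem_zeroLocus_iff, hp]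
  constructor
  · intro h q hq
    obtain ⟨r, rfl⟩ := Ideal.mem_span_singleton'.1 hq
    rw [map_mul, h, mul_zero]
  · exact fun h => h p (Ideal.mem_span_singleton_self p)

theorem isOpen_regular_ne_zero {f : MatrixTuple F d n → F} (hf : f ∈ regularFunctions F d n) :
    IsOpen {A | f A ≠ 0} :=
  (isClosed_regular_eq_zero hf).isOpen_compl

/-- A map between spaces of matrix tuples with polynomial entries is Zariski continuous. -/
theorem continuous_of_regular {φ : MatrixTuple F d n → MatrixTuple F d' n'}
    (hφ : ∀ i a b, (fun A => φ A i a b) ∈ regularFunctions F d n) : Continuous φ := by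
  rw [continuous_iff_isClosed]
  intro Z hZ
  obtain ⟨I, rfl⟩ := isClosed_iff.1 hZ
  have : φ ⁻¹' (MatrixTuple.coords ⁻¹' MvPolynomial.zeroLocus F I) =
      ⋂ p ∈ I, {A | MvPolynomial.aeval (φ A).coords p = 0} := by
    ext A
    simp [MvPolynomial.mem_zeroLocus_iff]
  rw [this]
  refine isClosed_biInter fun p _ => isClosed_regular_eq_zero ?_
  have h2 : (fun A => MvPolynomial.aeval (φ A).coords p) =
      MvPolynomial.aeval (fun (t : Fin d' × Fin n' × Fin n') A => (φ A).coords t) p := by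
    funext A
    have := MvPolynomial.comp_aeval_apply
      (fun (t : Fin d' × Fin n' × Fin n') (A : MatrixTuple F d n) => (φ A).coords t)
      (Pi.evalAlgHom F (fun _ : MatrixTuple F d n => F) A) p
    simpa using this.symm
  rw [h2]
  have h3 : Algebra.adjoin F (Set.range fun (t : Fin d' × Fin n' × Fin n') A => (φ A).coords t)
      ≤ regularFunctions F d n :=
    Algebra.adjoin_le (by rintro _ ⟨t, rfl⟩; exact hφ _ _ _)
  rw [Algebra.adjoin_range_eq_range_aeval] at h3
  exact h3 ⟨p, rfl⟩

/-- The affine space of matrix tuples over an infinite field is irreducible. -/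
theorem isIrreducible_univ [Infinite F] : IsIrreducible (Set.univ : Set (MatrixTuple F d n)) := by
  refine ⟨⟨0, trivial⟩, ?_⟩
  rintro U V hU hV ⟨x, -, hx⟩ ⟨y, -, hy⟩
  obtain ⟨I, hI⟩ := isClosed_iff.1 hU.isClosed_compl
  obtain ⟨J, hJ⟩ := isClosed_iff.1 hV.isClosed_compl
  have memU : ∀ A, A ∈ U ↔ A.coords ∉ MvPolynomial.zeroLocus F I := fun A => by
    rw [← Set.mem_preimage, ← hI, Set.mem_compl_iff, not_not]
  have memV : ∀ A, A ∈ V ↔ A.coords ∉ MvPolynomial.zeroLocus F J := fun A => by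
    rw [← Set.mem_preimage, ← hJ, Set.mem_compl_iff, not_not]
  rw [memU, MvPolynomial.mem_zeroLocus_iff] at hx
  rw [memV, MvPolynomial.mem_zeroLocus_iff] at hy
  push Not at hx hy
  obtain ⟨p, hp, hpx⟩ := hx
  obtain ⟨q, hq, hqy⟩ := hy
  have hne : p * q ≠ 0 :=
    mul_ne_zero (by rintro rfl; simp at hpx) (by rintro rfl; simp at hqy)
  obtain ⟨z, hz⟩ : ∃ z, MvPolynomial.eval z (p * q) ≠ 0 := by
    by_contra! h
    exact hne (MvPolynomial.funext fun z => by rw [h z, map_zero])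
  rw [map_mul] at hz
  let A : MatrixTuple F d n := fun i => Matrix.of fun a b => z (i, a, b)
  have hA : A.coords = z := rfl
  refine ⟨A, trivial, (memU A).2 fun h => left_ne_zero_of_mul hz ?_,
    (memV A).2 fun h => right_ne_zero_of_mul hz ?_⟩
  · simpa [hA, MvPolynomial.aeval_eq_eval] using h p hp
  · simpa [hA, MvPolynomial.aeval_eq_eval] using h q hq

/-! ### Matrices with polynomial entries -/

/-- A matrix-valued function is regular if all its entries are polynomial functions. -/
def IsRegularMatrix {k l : Type*} (M : MatrixTuple F d n → Matrix k l F) : Prop :=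
  ∀ a b, (fun A => M A a b) ∈ regularFunctions F d n

namespace IsRegularMatrix

variable {k l m : Type*}

theorem const (M : Matrix k l F) :
    IsRegularMatrix (fun _ : MatrixTuple F d n => M) :=
  fun a b => const_mem_regularFunctions (M a b)

theorem proj (i : Fin d) :
    IsRegularMatrix (fun A : MatrixTuple F d n => A i) :=
  fun a b => entry_mem_regularFunctions i a b

theorem mul [Fintype l] {M : MatrixTuple F d n → Matrix k l F} {N : MatrixTuple F d n → Matrix l m F}
    (hM : IsRegularMatrix M) (hN : IsRegularMatrix N) : IsRegularMatrix fun A => M A * N A := by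
  intro a b
  have : (fun A => (M A * N A) a b) = ∑ c, (fun A => M A a c) * (fun A => N A c b) := by
    funext A; simp [Matrix.mul_apply]
  rw [this]
  exact sum_mem fun c _ => mul_mem (hM a c) (hN c b)

theorem add {M N : MatrixTuple F d n → Matrix k l F}
    (hM : IsRegularMatrix M) (hN : IsRegularMatrix N) : IsRegularMatrix fun A => M A + N A :=
  fun a b => add_mem (hM a b) (hN a b)

theorem smul {f : MatrixTuple F d n → F} {M : MatrixTuple F d n → Matrix k l F}
    (hf : f ∈ regularFunctions F d n)
    (hM : IsRegularMatrix M) : IsRegularMatrix fun A => f A • M A :=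
  fun a b => mul_mem hf (hM a b)

theorem sum {ι : Type*} (s : Finset ι) {M : ι → MatrixTuple F d n → Matrix k l F}
    (hM : ∀ i ∈ s, IsRegularMatrix (M i)) : IsRegularMatrix fun A => ∑ i ∈ s, M i A := by
  intro a b
  have : (fun A => (∑ i ∈ s, M i A) a b) = ∑ i ∈ s, fun A => M i A a b := by
    funext A; simp [Matrix.sum_apply]
  rw [this]
  exact sum_mem fun c hc => hM c hc a b

theorem pow [Fintype k] [DecidableEq k] {M : MatrixTuple F d n → Matrix k k F}
    (hM : IsRegularMatrix M) (j : ℕ) : IsRegularMatrix fun A => M A ^ j := by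
  induction j with
  | zero => simpa using const 1
  | succ j ih => simpa only [pow_succ] using ih.mul hM

theorem det [Fintype k] [DecidableEq k] {M : MatrixTuple F d n → Matrix k k F}
    (hM : IsRegularMatrix M) : (fun A => (M A).det) ∈ regularFunctions F d n := by
  have : (fun A => (M A).det) =
      ∑ σ : Equiv.Perm k, (fun _ => ((Equiv.Perm.sign σ : ℤ) : F)) * ∏ i, fun A => M A (σ i) i := by
    funext A; simp [Matrix.det_apply']
  rw [this]
  exact sum_mem fun σ _ => mul_mem (const_mem_regularFunctions _) (prod_mem fun i _ => hM _ _)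

theorem adjugate [Fintype k] [DecidableEq k] {M : MatrixTuple F d n → Matrix k k F}
    (hM : IsRegularMatrix M) : IsRegularMatrix fun A => (M A).adjugate := by
  intro a b
  simp only [Matrix.adjugate_apply]
  refine det fun i j => ?_
  by_cases h : i = b
  · simpa [h] using const_mem_regularFunctions _
  · simpa [Matrix.updateRow_apply, h] using hM i j

theorem diagonal [DecidableEq k] {M : MatrixTuple F d n → k → F}
    (hM : ∀ a, (fun A => M A a) ∈ regularFunctions F d n) :
    IsRegularMatrix fun A => Matrix.diagonal (M A) := by
  intro a b
  by_cases h : a = b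
  · subst h; simpa using hM a
  · simpa [h] using const_mem_regularFunctions 0

end IsRegularMatrix

/-! ### Simultaneously diagonalizable tuples -/

/-- The tuples of matrices that are diagonal in a common basis. -/
def simultaneouslyDiagonalizable (F : Type*) [Field F] (d n : ℕ) : Set (MatrixTuple F d n) :=
  {A | ∃ P Q : Matrix (Fin n) (Fin n) F, P * Q = 1 ∧
    ∃ D : Fin d → Fin n → F, ∀ i, A i = P * diagonal (D i) * Q}

theorem simultaneouslyDiagonalizable_subset_commutingVariety :
    simultaneouslyDiagonalizable F d n ⊆ commutingVariety F d n := by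
  rintro A ⟨P, Q, hPQ, D, hA⟩ i j
  have hQP : Q * P = 1 := mul_eq_one_comm.1 hPQ
  have h : ∀ i j, A i * A j = P * (diagonal (D i) * diagonal (D j)) * Q := fun i j => by
    rw [hA, hA]
    simp only [Matrix.mul_assoc]
    rw [← Matrix.mul_assoc Q P, hQP, Matrix.one_mul]
  rw [commute_iff_eq, h, h, diagonal_mul_diagonal, diagonal_mul_diagonal]
  simp only [mul_comm]

/-- The parametrization uses the adjugate in place of the inverse to stay polynomial; the resulting
determinant factor is absorbed into the diagonal part. -/
theorem isIrreducible_simultaneouslyDiagonalizable [Infinite F] :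
    IsIrreducible (simultaneouslyDiagonalizable F d n) := by
  let φ : MatrixTuple F (d + 1) n → MatrixTuple F d n := fun T i =>
    T 0 * diagonal (fun a => T i.succ a a) * (T 0).adjugate
  have hφ : Continuous φ := continuous_of_regular fun i =>
    (((IsRegularMatrix.proj 0).mul
      (IsRegularMatrix.diagonal fun a => entry_mem_regularFunctions _ a a)).mul
      (IsRegularMatrix.proj 0).adjugate)
  have hU : IsIrreducible {T : MatrixTuple F (d + 1) n | (T 0).det ≠ 0} :=
    ⟨⟨fun _ => 1, by simp⟩, isIrreducible_univ.2.open_subset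
      (isOpen_regular_ne_zero (IsRegularMatrix.proj 0).det) (Set.subset_univ _)⟩
  have : simultaneouslyDiagonalizable F d n =
      φ '' {T : MatrixTuple F (d + 1) n | (T 0).det ≠ 0} := by
    ext A
    constructor
    · rintro ⟨P, Q, hPQ, D, hA⟩
      have hdet : P.det ≠ 0 := (Matrix.isUnit_det_of_right_inverse hPQ).ne_zero
      have hQ : Q = P.det⁻¹ • P.adjugate := by
        rw [← Matrix.inv_eq_right_inv hPQ, Matrix.inv_def, Ring.inverse_eq_inv']
      refine ⟨Fin.cons P fun i => diagonal (P.det⁻¹ • D i), by simpa using hdet, ?_⟩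
      funext i
      simp only [φ, Fin.cons_zero, Fin.cons_succ, hA, hQ, diagonal_apply_eq]
      rw [diagonal_smul]
      simp
    · rintro ⟨T, hT, rfl⟩
      refine ⟨T 0, (T 0).det⁻¹ • (T 0).adjugate, ?_,
        fun i => (T 0).det • fun a => T i.succ a a, fun i => ?_⟩
      · rw [Matrix.mul_smul, Matrix.mul_adjugate, smul_smul, inv_mul_cancel₀ hT, one_smul]
      · rw [diagonal_smul]
        simp [φ, smul_smul, inv_mul_cancel₀ (show (T 0).det ≠ 0 from hT)]
  rw [this]
  exact hU.image φ hφ.continuousOn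

/-! ### Density of diagonalizable matrices -/

/-- The entries of `χ'(M)`, for `χ` the characteristic polynomial of `M`, are polynomials in the
entries of `M`. -/
theorem isRegularMatrix_aeval_derivative_charpoly (i : Fin d) :
    IsRegularMatrix fun A : MatrixTuple F d n =>
      Polynomial.aeval (A i) (A i).charpoly.derivative := by
  let R := regularFunctions F d n
  let ev : MatrixTuple F d n → R →+* F := fun A => (Pi.evalRingHom _ A).comp R.val.toRingHom
  -- The generic matrix over the ring of polynomial functions: forming its characteristic polynomial
  -- commutes with evaluation at `A`, so the coefficients are polynomial functions.
  let X : Matrix (Fin n) (Fin n) R :=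
    Matrix.of fun a b => ⟨fun A => A i a b, entry_mem_regularFunctions i a b⟩
  have hX : ∀ A, X.map (ev A) = A i := fun A => rfl
  have hcoeff : ∀ k, (fun A : MatrixTuple F d n => (A i).charpoly.derivative.coeff k) ∈ R := by
    intro k
    convert (X.charpoly.derivative.coeff k).2 using 1
    funext A
    rw [← hX A, Matrix.charpoly_map, Polynomial.derivative_map, Polynomial.coeff_map]
    rfl
  have hdeg : ∀ A : MatrixTuple F d n, (A i).charpoly.derivative.natDegree < n + 1 := fun A => by
    have := Polynomial.natDegree_derivative_le (A i).charpoly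
    rw [Matrix.charpoly_natDegree_eq_dim, Fintype.card_fin] at this
    omega
  simp only [fun A => Polynomial.aeval_eq_sum_range' (hdeg A) (A i)]
  exact IsRegularMatrix.sum _ fun k _ =>
    IsRegularMatrix.smul (hcoeff k) ((IsRegularMatrix.proj i).pow k)

/-- A matrix `M` with characteristic polynomial `χ` such that `χ'(M)` is invertible is
diagonalizable. -/
theorem exists_diagonal_of_det_aeval_derivative_charpoly_ne_zero [IsAlgClosed F]
    (M : Matrix (Fin n) (Fin n) F) (hM : (Polynomial.aeval M M.charpoly.derivative).det ≠ 0) :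
    ∃ P Q : Matrix (Fin n) (Fin n) F, P * Q = 1 ∧ ∃ D : Fin n → F, M = P * diagonal D * Q := by
  classical
  have hmonic := M.charpoly_monic
  have eig : ∀ r, M.charpoly.IsRoot r → Module.End.HasEigenvalue (toLin' M) r := fun r hr => by
    rw [Module.End.hasEigenvalue_iff_isRoot_charpoly, Matrix.charpoly_toLin']
    exact hr
  have hnodup : M.charpoly.roots.Nodup := by
    rw [Multiset.nodup_iff_count_le_one]
    intro r
    by_contra! h
    rw [Polynomial.count_roots, Polynomial.one_lt_rootMultiplicity_iff_isRoot hmonic.ne_zero] at h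
    -- At a multiple root `r`, an eigenvector satisfies χ'(M)v = χ'(r)v = 0, contradicting
    -- invertibility.
    obtain ⟨v, hv⟩ := (eig r h.1).exists_hasEigenvector
    apply hM
    rw [← Matrix.exists_mulVec_eq_zero_iff]
    refine ⟨v, hv.2, ?_⟩
    have h2 := Module.End.aeval_apply_of_hasEigenvector (p := M.charpoly.derivative) hv
    rw [h.2, zero_smul] at h2
    have h3 : Polynomial.aeval (toLin' M) M.charpoly.derivative =
        toLin' (Polynomial.aeval M M.charpoly.derivative) :=
      Polynomial.aeval_algHom_apply (Matrix.toLinAlgEquiv' (R := F) (n := Fin n)).toAlgHom M _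
    rw [h3] at h2
    simpa using h2
  have hcard : M.charpoly.roots.toFinset.card = n := by
    rw [Multiset.toFinset_card_of_nodup hnodup,
      ← (IsAlgClosed.splits M.charpoly).natDegree_eq_card_roots, M.charpoly_natDegree_eq_dim,
      Fintype.card_fin]
  let e := (M.charpoly.roots.toFinset.equivFinOfCardEq hcard).symm
  have hev : ∀ i, Module.End.HasEigenvalue (toLin' M) (e i) := fun i =>
    eig _ (Polynomial.isRoot_of_mem_roots (Multiset.mem_toFinset.1 (e i).2))
  choose v hv using fun i => (hev i).exists_hasEigenvector
  have hli := Module.End.eigenvectors_linearIndependent' (toLin' M) (fun i => (e i : F))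
    (Subtype.val_injective.comp e.injective) v hv
  let P : Matrix (Fin n) (Fin n) F := Matrix.of fun a i => v i a
  have hP : IsUnit P := Matrix.linearIndependent_cols_iff_isUnit.1 hli
  have hPP : P * P⁻¹ = 1 := Matrix.mul_nonsing_inv P ((Matrix.isUnit_iff_isUnit_det P).1 hP)
  refine ⟨P, P⁻¹, hPP, fun i => e i, ?_⟩
  have : M * P = P * diagonal fun i => (e i : F) := by
    ext a i
    have := congrFun (hv i).apply_eq_smul a
    rw [Matrix.mul_diagonal]
    simpa [Matrix.mul_apply, Matrix.mulVec, dotProduct, P, mul_comm] using this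
  rw [← this, Matrix.mul_assoc, hPP, Matrix.mul_one]

/-- For a diagonal matrix with distinct entries x_i, χ'(x_i) is the product of x_i - x_j over j ≠ i,
which is nonzero in every characteristic. -/
theorem exists_det_aeval_derivative_charpoly_ne_zero [Infinite F] (n : ℕ) :
    ∃ M : Matrix (Fin n) (Fin n) F, (Polynomial.aeval M M.charpoly.derivative).det ≠ 0 := by
  obtain ⟨x⟩ : Nonempty (Fin n ↪ F) := ⟨Fin.valEmbedding.trans (Infinite.natEmbedding F)⟩
  refine ⟨diagonal x, ?_⟩
  have h : ∀ p : Polynomial F,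
      Polynomial.aeval (diagonal x) p = diagonal fun i => p.eval (x i) := fun p => by
    have h2 := Polynomial.aeval_algHom_apply (Matrix.diagonalAlgHom F (n := Fin n)) (x : Fin n → F) p
    rw [Matrix.diagonalAlgHom_apply, Matrix.diagonalAlgHom_apply] at h2
    rw [h2]
    congr 1
    funext i
    have := Polynomial.aeval_algHom_apply (Pi.evalAlgHom F (fun _ : Fin n => F) i) (x : Fin n → F) p
    rw [Pi.evalAlgHom_apply, Pi.evalAlgHom_apply, Polynomial.coe_aeval_eq_eval] at this
    exact this.symm
  rw [h, det_diagonal, Finset.prod_ne_zero_iff]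
  intro i _
  rw [charpoly_diagonal, Polynomial.derivative_prod_finset, Polynomial.eval_finsetSum,
    Finset.sum_eq_single i]
  · simp [Polynomial.eval_prod, Finset.prod_eq_zero_iff, sub_eq_zero, x.injective.eq_iff]
  · intro j _ hj
    rw [Polynomial.eval_mul, Polynomial.eval_prod,
      Finset.prod_eq_zero (Finset.mem_erase.2 ⟨hj.symm, Finset.mem_univ i⟩) (by simp), zero_mul]
  · simp

/-- Diagonalizable matrices are Zariski dense in the space of all matrices. -/
theorem closure_simultaneouslyDiagonalizable_one [IsAlgClosed F] :
    closure (simultaneouslyDiagonalizable F 1 n) = Set.univ := by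
  have : Infinite F := IsAlgClosed.instInfinite
  have hopen : IsOpen {A : MatrixTuple F 1 n |
      (Polynomial.aeval (A 0) (A 0).charpoly.derivative).det ≠ 0} :=
    isOpen_regular_ne_zero (isRegularMatrix_aeval_derivative_charpoly 0).det
  obtain ⟨M, hM⟩ := exists_det_aeval_derivative_charpoly_ne_zero (F := F) n
  have h := subset_closure_inter_of_isPreirreducible_of_isOpen
    (isIrreducible_univ (F := F) (d := 1) (n := n)).2 hopen ⟨fun _ => M, trivial, hM⟩
  refine Set.univ_subset_iff.1 (h.trans (closure_mono ?_))
  rintro A ⟨-, hA⟩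
  obtain ⟨P, Q, hPQ, D, hD⟩ := exists_diagonal_of_det_aeval_derivative_charpoly_ne_zero _ hA
  exact ⟨P, Q, hPQ, fun _ => D, fun i => by rw [Subsingleton.elim i 0, hD]⟩

/-! ### Polynomials in one matrix and cyclic vectors -/

/-- Polynomial expressions in one matrix lie in the closure of the simultaneously diagonalizable
tuples. -/
theorem polynomials_mem_closure [IsAlgClosed F] (c : Fin d → Fin n → F)
    (B : Matrix (Fin n) (Fin n) F) :
    (fun i => ∑ j : Fin n, c i j • B ^ (j : ℕ)) ∈
      closure (simultaneouslyDiagonalizable F d n) := by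
  let ψ : MatrixTuple F 1 n → MatrixTuple F d n := fun T i => ∑ j : Fin n, c i j • T 0 ^ (j : ℕ)
  have hψ : Continuous ψ := continuous_of_regular fun i =>
    IsRegularMatrix.sum _ fun j _ =>
      IsRegularMatrix.smul (const_mem_regularFunctions _) ((IsRegularMatrix.proj 0).pow _)
  have hmaps : Set.MapsTo ψ (simultaneouslyDiagonalizable F 1 n)
      (simultaneouslyDiagonalizable F d n) := by
    rintro T ⟨P, Q, hPQ, D, hT⟩
    have hQP : Q * P = 1 := mul_eq_one_comm.1 hPQ
    refine ⟨P, Q, hPQ, fun i => ∑ j : Fin n, c i j • D 0 ^ (j : ℕ), fun i => ?_⟩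
    have hpow : ∀ j : ℕ, T 0 ^ j = P * diagonal (D 0 ^ j) * Q := fun j => by
      induction j with
      | zero => simp [hPQ]
      | succ j ih =>
        rw [pow_succ, ih, hT, pow_succ,
          show diagonal (D 0 ^ j * D 0) = diagonal (D 0 ^ j) * diagonal (D 0) from
            (diagonal_mul_diagonal _ _).symm]
        simp only [Matrix.mul_assoc]
        rw [← Matrix.mul_assoc Q P, hQP, Matrix.one_mul]
    have hsum : diagonal (∑ j : Fin n, c i j • D 0 ^ (j : ℕ)) =
        ∑ j : Fin n, c i j • diagonal (D 0 ^ (j : ℕ)) := by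
      simp only [← diagonal_smul]
      exact map_sum (Matrix.diagonalAddMonoidHom (Fin n) F) _ _
    simp only [ψ, hpow, hsum, Matrix.mul_sum, Matrix.sum_mul, Matrix.mul_smul, Matrix.smul_mul]
  -- By density, the closure on the source side is the whole space and so contains `B`.
  have := hmaps.closure hψ
  rw [closure_simultaneouslyDiagonalizable_one] at this
  exact this (Set.mem_univ fun _ => B)

/-- The Krylov matrix of `M` with respect to the first basis vector. -/
def krylov [NeZero n] (M : Matrix (Fin n) (Fin n) F) : Matrix (Fin n) (Fin n) F :=
  Matrix.of fun a j => (M ^ (j : ℕ)) a 0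

theorem krylov_mulVec [NeZero n] (M : Matrix (Fin n) (Fin n) F) (c : Fin n → F) :
    krylov M *ᵥ c = fun a => (∑ j : Fin n, c j • M ^ (j : ℕ)) a 0 := by
  funext a
  simp [krylov, Matrix.mulVec, dotProduct, Matrix.sum_apply, mul_comm]

/-- If the first basis vector is cyclic for `M`, then every matrix commuting with `M` is a
polynomial in `M`. -/
theorem exists_eq_sum_pow_of_commute [NeZero n] {M N : Matrix (Fin n) (Fin n) F}
    (hM : (krylov M).det ≠ 0) (h : Commute M N) :
    ∃ c : Fin n → F, N = ∑ j : Fin n, c j • M ^ (j : ℕ) := by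
  have hunit : IsUnit (krylov M).det := hM.isUnit
  refine ⟨(krylov M)⁻¹ *ᵥ fun a => N a 0, ?_⟩
  set c := (krylov M)⁻¹ *ᵥ fun a => N a 0 with hc
  set p := ∑ j : Fin n, c j • M ^ (j : ℕ) with hp
  have h0 : ∀ a, N a 0 = p a 0 := fun a => by
    have h1 := krylov_mulVec M c
    rw [hc, Matrix.mulVec_mulVec, Matrix.mul_nonsing_inv _ hunit, Matrix.one_mulVec] at h1
    exact congrFun h1 a
  have hpM : Commute M p :=
    Commute.sum_right _ _ _ fun j _ => ((Commute.refl M).pow_right _).smul_right _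
  -- `N` and `p` agree on the first basis vector and commute with `M`, so they agree on every column
  -- of the Krylov matrix.
  have key : N * krylov M = p * krylov M := by
    ext a j
    have e : ∀ X : Matrix (Fin n) (Fin n) F, Commute M X →
        (X * krylov M) a j = ∑ b, (M ^ (j : ℕ)) a b * X b 0 := fun X hX => by
      have : (X * krylov M) a j = (X * M ^ (j : ℕ)) a 0 := by
        simp [krylov, Matrix.mul_apply]
      rw [this, ← (hX.pow_left _).eq, Matrix.mul_apply]
    rw [e N h, e p hpM]
    simp only [h0]
  have := congrArg (· * (krylov M)⁻¹) key
  simpa [Matrix.mul_assoc, Matrix.mul_nonsing_inv _ hunit] using this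

/-- The nilpotent shift matrix. -/
def shift (F : Type*) [Field F] (n : ℕ) : Matrix (Fin n) (Fin n) F :=
  Matrix.of fun a b => if (a : ℕ) = b + 1 then 1 else 0

theorem shift_pow_apply (k : ℕ) (a b : Fin n) :
    (shift F n ^ k) a b = if (a : ℕ) = b + k then 1 else 0 := by
  induction k generalizing a with
  | zero => simp [Matrix.one_apply, Fin.ext_iff]
  | succ k ih =>
    rw [pow_succ', Matrix.mul_apply]
    simp only [ih, show ∀ x, shift F n a x = if (a : ℕ) = x + 1 then 1 else 0 from fun _ => rfl]
    by_cases h : (a : ℕ) = b + (k + 1)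
    · rw [if_pos h, Finset.sum_eq_single (⟨b + k, by omega⟩ : Fin n)]
      · simp [h, add_assoc]
      · intro x _ hx
        have : (x : ℕ) ≠ b + k := fun hh => hx (Fin.ext hh)
        simp [this]
      · simp
    · rw [if_neg h]
      refine Finset.sum_eq_zero fun x _ => ?_
      by_cases hx : (x : ℕ) = b + k
      · have : (a : ℕ) ≠ x + 1 := by omega
        simp [this]
      · simp [hx]

theorem isNilpotent_shift : IsNilpotent (shift F n) := by
  refine ⟨n, ?_⟩
  ext a b
  rw [shift_pow_apply, if_neg (by omega), Matrix.zero_apply]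

/-- The powers of the shift carry the first basis vector through the whole basis; this is what makes
the cyclic locus nonempty. -/
theorem krylov_shift [NeZero n] : krylov (shift F n) = 1 := by
  ext a j
  simp [krylov, shift_pow_apply, Matrix.one_apply, Fin.ext_iff]

/-- The tuple `(J, 0, …, 0)`, where `J` is the shift matrix. -/
def shiftTuple (F : Type*) [Field F] (d n : ℕ) [NeZero d] : MatrixTuple F d n :=
  fun i => if i = 0 then shift F n else 0

theorem shiftTuple_mem_nilpotentCommutingVariety [NeZero d] :
    shiftTuple F d n ∈ nilpotentCommutingVariety F d n := by
  refine ⟨fun i j => ?_, fun i => ?_⟩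
  · unfold shiftTuple
    split_ifs <;> simp
  · unfold shiftTuple
    split_ifs
    exacts [isNilpotent_shift, IsNilpotent.zero]

/-- An irreducible set of commuting tuples containing `(J, 0, …, 0)` lies in the closure of the
simultaneously diagonalizable tuples. -/
theorem subset_closure_of_shiftTuple_mem [IsAlgClosed F] [NeZero n] [NeZero d]
    {S : Set (MatrixTuple F d n)} (hS : IsIrreducible S) (hSC : S ⊆ commutingVariety F d n)
    (hmem : shiftTuple F d n ∈ S) : S ⊆ closure (simultaneouslyDiagonalizable F d n) := by
  have hopen : IsOpen {A : MatrixTuple F d n | (krylov (A 0)).det ≠ 0} :=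
    isOpen_regular_ne_zero (IsRegularMatrix.det fun a j => (IsRegularMatrix.proj 0).pow _ a 0)
  refine (subset_closure_inter_of_isPreirreducible_of_isOpen hS.2 hopen
    ⟨_, hmem, by simp [shiftTuple, krylov_shift]⟩).trans
    (closure_minimal ?_ isClosed_closure)
  rintro A ⟨hA, hdet⟩
  choose c hc using fun i => exists_eq_sum_pow_of_commute hdet (hSC hA 0 i)
  have := polynomials_mem_closure c (A 0)
  rwa [← funext hc] at this

/-! ### Stability of the closure under translations and direct sums -/

/-- Scalar translations preserve the closure of the simultaneously diagonalizable tuples. -/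
theorem add_scalar_mem_closure {A : MatrixTuple F d n}
    (hA : A ∈ closure (simultaneouslyDiagonalizable F d n)) (c : Fin d → F) :
    (fun i => A i + c i • (1 : Matrix (Fin n) (Fin n) F)) ∈
      closure (simultaneouslyDiagonalizable F d n) := by
  have hφ : Continuous fun (A : MatrixTuple F d n) (i : Fin d) =>
      A i + c i • (1 : Matrix (Fin n) (Fin n) F) :=
    continuous_of_regular fun i => (IsRegularMatrix.proj i).add (IsRegularMatrix.const _)
  refine Set.MapsTo.closure ?_ hφ hA
  rintro A ⟨P, Q, hPQ, D, hD⟩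
  refine ⟨P, Q, hPQ, fun i => D i + c i • 1, fun i => ?_⟩
  have : diagonal (D i + c i • (1 : Fin n → F)) = diagonal (D i) + c i • 1 := by
    rw [← diagonal_one, ← diagonal_smul, diagonal_add]; rfl
  simp only [this, hD, Matrix.mul_add, Matrix.add_mul, Matrix.mul_smul, Matrix.smul_mul,
    Matrix.mul_one, hPQ]

/-- Direct sums, in any basis, preserve the closures of the simultaneously diagonalizable
tuples. -/
theorem fromBlocks_mem_closure {m k : ℕ} {P : Matrix (Fin n) (Fin m ⊕ Fin k) F}
    {Q : Matrix (Fin m ⊕ Fin k) (Fin n) F} (hPQ : P * Q = 1) (hn : m + k = n)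
    {X : MatrixTuple F d m} (hX : X ∈ closure (simultaneouslyDiagonalizable F d m))
    {Y : MatrixTuple F d k} (hY : Y ∈ closure (simultaneouslyDiagonalizable F d k)) :
    (fun i => P * fromBlocks (X i) 0 0 (Y i) * Q) ∈
      closure (simultaneouslyDiagonalizable F d n) := by
  subst hn
  let φ : MatrixTuple F d m → MatrixTuple F d k → MatrixTuple F d (m + k) :=
    fun X Y i => P * fromBlocks (X i) 0 0 (Y i) * Q
  have hφ₁ : ∀ Y, Continuous fun X => φ X Y := fun Y => continuous_of_regular fun i => by
    refine ((IsRegularMatrix.const P).mul ?_).mul (IsRegularMatrix.const Q)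
    rintro (a | a) (b | b)
    exacts [entry_mem_regularFunctions i a b, const_mem_regularFunctions _,
      const_mem_regularFunctions _, const_mem_regularFunctions _]
  have hφ₂ : ∀ X, Continuous (φ X) := fun X => continuous_of_regular fun i => by
    refine ((IsRegularMatrix.const P).mul ?_).mul (IsRegularMatrix.const Q)
    rintro (a | a) (b | b)
    exacts [const_mem_regularFunctions _, const_mem_regularFunctions _,
      const_mem_regularFunctions _, entry_mem_regularFunctions i a b]
  have hφ : ∀ X ∈ simultaneouslyDiagonalizable F d m, ∀ Y ∈ simultaneouslyDiagonalizable F d k,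
      φ X Y ∈ simultaneouslyDiagonalizable F d (m + k) := by
    rintro X ⟨P₁, Q₁, h₁, D₁, hX⟩ Y ⟨P₂, Q₂, h₂, D₂, hY⟩
    let e : Fin m ⊕ Fin k ≃ Fin (m + k) := finSumFinEquiv
    let R : Matrix (Fin m ⊕ Fin k) (Fin (m + k)) F :=
      (fromBlocks P₁ 0 0 P₂).submatrix id e.symm
    let S : Matrix (Fin (m + k)) (Fin m ⊕ Fin k) F :=
      (fromBlocks Q₁ 0 0 Q₂).submatrix e.symm id
    have hRS : R * S = 1 := by
      simp only [R, S, Matrix.submatrix_mul_equiv, fromBlocks_multiply, h₁, h₂]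
      simp
    refine ⟨P * R, S * Q, ?_, fun i => Sum.elim (D₁ i) (D₂ i) ∘ e.symm, fun i => ?_⟩
    · rw [Matrix.mul_assoc, ← Matrix.mul_assoc R, hRS, Matrix.one_mul, hPQ]
    · have hdiag : diagonal (Sum.elim (D₁ i) (D₂ i) ∘ e.symm) =
          (fromBlocks (diagonal (D₁ i)) 0 0 (diagonal (D₂ i))).submatrix e.symm e.symm := by
        rw [fromBlocks_diagonal, submatrix_diagonal_equiv]
      have : R * diagonal (Sum.elim (D₁ i) (D₂ i) ∘ e.symm) * S =
          fromBlocks (X i) 0 0 (Y i) := by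
        simp only [R, S, hdiag, Matrix.submatrix_mul_equiv, fromBlocks_multiply, hX, hY]
        simp
      simp only [φ, ← this, Matrix.mul_assoc]
  -- The closure is taken in one variable at a time, so only separate continuity is needed and no
  -- topology on the product enters.
  have h₁ : Set.MapsTo (fun X => φ X Y) (simultaneouslyDiagonalizable F d m)
      (closure (simultaneouslyDiagonalizable F d (m + k))) := fun X hX =>
    Set.MapsTo.closure (fun Y hY => hφ X hX Y hY) (hφ₂ X) hY
  have := h₁.closure (hφ₁ Y) hX
  rwa [closure_closure] at this

/-! ### Fitting decomposition -/

/-- A matrix over an algebraically closed field either has a single eigenvalue, or some matrix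
commuting with its whole centralizer yields a nontrivial Fitting decomposition. -/
theorem exists_isNilpotent_sub_or_exists_isCompl [IsAlgClosed F] [NeZero n]
    (M : Matrix (Fin n) (Fin n) F) :
    (∃ c : F, IsNilpotent (M - c • (1 : Matrix (Fin n) (Fin n) F))) ∨
    ∃ H : Matrix (Fin n) (Fin n) F, (∀ N, Commute M N → Commute H N) ∧
      IsCompl (LinearMap.ker (toLin' H)) (LinearMap.range (toLin' H)) ∧
      LinearMap.ker (toLin' H) ≠ ⊥ ∧ LinearMap.range (toLin' H) ≠ ⊥ := by
  obtain ⟨c, hc⟩ := Module.End.exists_eigenvalue (toLin' M)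
  obtain ⟨v, hv⟩ := hc.exists_hasEigenvector
  set N := M - c • (1 : Matrix (Fin n) (Fin n) F) with hN
  -- A large power gives the Fitting splitting; `k ≥ 1` ensures that the eigenvector `v` lies in its
  -- kernel.
  obtain ⟨k, hk, hk1⟩ := ((toLin' N).eventually_isCompl_ker_pow_range_pow.and
    (Filter.eventually_ge_atTop 1)).exists
  rw [← toLin'_pow] at hk
  by_cases hr : LinearMap.range (toLin' (N ^ k)) = ⊥
  · left
    refine ⟨c, k, ?_⟩
    rwa [LinearMap.range_eq_bot, LinearEquiv.map_eq_zero_iff] at hr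
  · right
    refine ⟨N ^ k, fun L hL => ?_, hk, ?_, hr⟩
    · exact (hL.sub_left ((Commute.one_left L).smul_left c)).pow_left k
    · rw [Submodule.ne_bot_iff]
      refine ⟨v, ?_, hv.2⟩
      have hNv : N *ᵥ v = 0 := by
        have := hv.apply_eq_smul
        rw [toLin'_apply] at this
        rw [hN, Matrix.sub_mulVec, Matrix.smul_mulVec, Matrix.one_mulVec, this, sub_self]
      obtain ⟨j, rfl⟩ : ∃ j, k = j + 1 := ⟨k - 1, by omega⟩
      rw [LinearMap.mem_ker, toLin'_apply, pow_succ, ← Matrix.mulVec_mulVec, hNv,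
        Matrix.mulVec_zero]

/-- Matrices commuting with `H` are simultaneously block diagonal along a Fitting decomposition
of `H`. -/
theorem exists_fromBlocks_of_isCompl {H : Matrix (Fin n) (Fin n) F}
    (hcompl : IsCompl (LinearMap.ker (toLin' H)) (LinearMap.range (toLin' H)))
    (hker : LinearMap.ker (toLin' H) ≠ ⊥) (hrange : LinearMap.range (toLin' H) ≠ ⊥)
    {A : MatrixTuple F d n} (hA : ∀ i, Commute H (A i)) :
    ∃ m k : ℕ, 0 < m ∧ 0 < k ∧ m + k = n ∧
      ∃ (P : Matrix (Fin n) (Fin m ⊕ Fin k) F) (Q : Matrix (Fin m ⊕ Fin k) (Fin n) F)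
        (X : MatrixTuple F d m) (Y : MatrixTuple F d k), P * Q = 1 ∧ Q * P = 1 ∧
        ∀ i, A i = P * fromBlocks (X i) 0 0 (Y i) * Q := by
  set p := LinearMap.ker (toLin' H)
  set q := LinearMap.range (toLin' H)
  let bp := Module.finBasis F p
  let bq := Module.finBasis F q
  have hp : ∀ i, ∀ v ∈ p, toLin' (A i) v ∈ p := fun i v hv => by
    rw [LinearMap.mem_ker, toLin'_apply] at hv ⊢
    rw [toLin'_apply, Matrix.mulVec_mulVec, (hA i).eq, ← Matrix.mulVec_mulVec, hv,
      Matrix.mulVec_zero]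
  have hq : ∀ i, ∀ v ∈ q, toLin' (A i) v ∈ q := by
    rintro i _ ⟨w, rfl⟩
    refine ⟨toLin' (A i) w, ?_⟩
    simp only [toLin'_apply, Matrix.mulVec_mulVec, (hA i).eq]
  let b : Module.Basis (Fin (Module.finrank F p) ⊕ Fin (Module.finrank F q)) F (Fin n → F) :=
    (bp.prod bq).map (Submodule.prodEquivOfIsCompl p q hcompl)
  let s := Pi.basisFun F (Fin n)
  let X : MatrixTuple F d (Module.finrank F p) := fun i =>
    LinearMap.toMatrix bp bp ((toLin' (A i)).restrict (hp i))
  let Y : MatrixTuple F d (Module.finrank F q) := fun i =>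
    LinearMap.toMatrix bq bq ((toLin' (A i)).restrict (hq i))
  have hPQ : s.toMatrix b * b.toMatrix s = 1 := Module.Basis.toMatrix_mul_toMatrix_flip s b
  have hQP : b.toMatrix s * s.toMatrix b = 1 := Module.Basis.toMatrix_mul_toMatrix_flip b s
  have hinl : ∀ j, b (Sum.inl j) = bp j := fun j => by simp [b]
  have hinr : ∀ j, b (Sum.inr j) = bq j := fun j => by simp [b]
  have key : ∀ i, LinearMap.toMatrix b b (toLin' (A i)) = fromBlocks (X i) 0 0 (Y i) := by
    intro i
    have hl : ∀ j, toLin' (A i) (b (Sum.inl j)) = Submodule.prodEquivOfIsCompl p q hcompl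
        ((toLin' (A i)).restrict (hp i) (bp j), 0) := fun j => by simp [hinl]
    have hr : ∀ j, toLin' (A i) (b (Sum.inr j)) = Submodule.prodEquivOfIsCompl p q hcompl
        (0, (toLin' (A i)).restrict (hq i) (bq j)) := fun j => by simp [hinr]
    have hrepr : ∀ z, b.repr (Submodule.prodEquivOfIsCompl p q hcompl z) =
        (bp.prod bq).repr z := fun z => by
      change (bp.prod bq).repr ((Submodule.prodEquivOfIsCompl p q hcompl).symm
        (Submodule.prodEquivOfIsCompl p q hcompl z)) = _
      rw [LinearEquiv.symm_apply_apply]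
    ext x y
    rw [LinearMap.toMatrix_apply]
    rcases y with y | y
    · rw [hl, hrepr]
      rcases x with x | x <;> simp [X, LinearMap.toMatrix_apply]
    · rw [hr, hrepr]
      rcases x with x | x <;> simp [Y, LinearMap.toMatrix_apply]
  refine ⟨Module.finrank F p, Module.finrank F q, ?_, ?_, ?_, s.toMatrix b, b.toMatrix s, X, Y,
    hPQ, hQP, fun i => ?_⟩
  · exact Nat.pos_of_ne_zero fun h => hker (Submodule.finrank_eq_zero.1 h)
  · exact Nat.pos_of_ne_zero fun h => hrange (Submodule.finrank_eq_zero.1 h)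
  · rw [Submodule.finrank_add_eq_of_isCompl hcompl, Module.finrank_fin_fun]
  · rw [← key, basis_toMatrix_mul_linearMap_toMatrix_mul_basis_toMatrix]
    exact (LinearMap.toMatrix'_toLin' (A i)).symm

/-- Undoing the conjugation leaves block diagonal products, which are compared block by block. -/
theorem commute_of_fromBlocks {m k : ℕ} {P : Matrix (Fin n) (Fin m ⊕ Fin k) F}
    {Q : Matrix (Fin m ⊕ Fin k) (Fin n) F} (hQP : Q * P = 1)
    {X X' : Matrix (Fin m) (Fin m) F} {Y Y' : Matrix (Fin k) (Fin k) F}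
    (h : Commute (P * fromBlocks X 0 0 Y * Q) (P * fromBlocks X' 0 0 Y' * Q)) :
    Commute X X' ∧ Commute Y Y' := by
  have e : ∀ Z Z' : Matrix (Fin m ⊕ Fin k) (Fin m ⊕ Fin k) F,
      Q * ((P * Z * Q) * (P * Z' * Q)) * P = Z * Z' := fun Z Z' => by
    have : Q * ((P * Z * Q) * (P * Z' * Q)) * P = (Q * P) * Z * (Q * P) * Z' * (Q * P) := by
      simp only [Matrix.mul_assoc]
    rw [this, hQP]
    simp
  have h2 := congrArg (fun W => Q * W * P) h.eq
  simp only [e, fromBlocks_multiply] at h2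
  rw [fromBlocks_inj] at h2
  simpa [commute_iff_eq] using And.intro h2.1 h2.2.2.2

theorem isIrreducible_of_subsingleton [Subsingleton (MatrixTuple F d n)] :
    IsIrreducible (commutingVariety F d n) :=
  ⟨⟨0, fun _ _ => Commute.zero_left _⟩, Set.subsingleton_of_subsingleton.isPreirreducible⟩

/-! ### The reduction to nilpotent tuples -/

/-- Irreducibility of `C(d, m)` for `0 < m < n` and of `N(d, n)` implies that of `C(d, n)`. -/
theorem isIrreducible_commutingVariety [IsAlgClosed F]
    (hC : ∀ m : ℕ, 0 < m → m < n → IsIrreducible (commutingVariety F d m))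
    (hN : IsIrreducible (nilpotentCommutingVariety F d n)) :
    IsIrreducible (commutingVariety F d n) := by
  -- The degenerate cases go first, since (J, 0, …, 0) needs a first matrix and a first basis
  -- vector.
  rcases Nat.eq_zero_or_pos d with rfl | hd
  · exact isIrreducible_of_subsingleton
  rcases Nat.eq_zero_or_pos n with rfl | hn
  · exact isIrreducible_of_subsingleton
  have : NeZero d := ⟨hd.ne'⟩
  have : NeZero n := ⟨hn.ne'⟩
  have : Infinite F := IsAlgClosed.instInfinite
  have hCm : ∀ m : ℕ, 0 < m → m < n →
      commutingVariety F d m ⊆ closure (simultaneouslyDiagonalizable F d m) := fun m hm hmn => by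
    have : NeZero m := ⟨hm.ne'⟩
    exact subset_closure_of_shiftTuple_mem (hC m hm hmn) subset_rfl
      shiftTuple_mem_nilpotentCommutingVariety.1
  have hNn : nilpotentCommutingVariety F d n ⊆ closure (simultaneouslyDiagonalizable F d n) :=
    subset_closure_of_shiftTuple_mem hN (fun A hA => hA.1) shiftTuple_mem_nilpotentCommutingVariety
  have hsub : commutingVariety F d n ⊆ closure (simultaneouslyDiagonalizable F d n) := by
    intro A hA
    by_cases hsingle :
        ∀ i, ∃ c : F, IsNilpotent (A i - c • (1 : Matrix (Fin n) (Fin n) F))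
    · choose c hc using hsingle
      have hmem : (fun i => A i - c i • (1 : Matrix (Fin n) (Fin n) F)) ∈
          nilpotentCommutingVariety F d n := by
        refine ⟨fun i j => ?_, hc⟩
        exact ((hA i j).sub_right ((Commute.one_right _).smul_right _)).sub_left
          ((Commute.one_left _).smul_left _)
      simpa using add_scalar_mem_closure (hNn hmem) c
    · push Not at hsingle
      obtain ⟨i₀, hi₀⟩ := hsingle
      obtain ⟨H, hH, hcompl, hker, hrange⟩ :=
        (exists_isNilpotent_sub_or_exists_isCompl (A i₀)).resolve_left
          fun ⟨c, hc⟩ => hi₀ c hc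
      -- `H` commutes with everything that commutes with `A i₀`, hence with the whole tuple; both
      -- summands are nonzero, so both blocks have size less than `n`.
      obtain ⟨m, k, hm, hk, hmk, P, Q, X, Y, hPQ, hQP, hXY⟩ :=
        exists_fromBlocks_of_isCompl hcompl hker hrange fun i => hH _ (hA i₀ i)
      have hcomm : ∀ i j, Commute (X i) (X j) ∧ Commute (Y i) (Y j) := fun i j =>
        commute_of_fromBlocks hQP (by rw [← hXY, ← hXY]; exact hA i j)
      rw [show A = fun i => P * fromBlocks (X i) 0 0 (Y i) * Q from funext hXY]
      exact fromBlocks_mem_closure hPQ hmk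
        (hCm m hm (by omega) fun i j => (hcomm i j).1)
        (hCm k hk (by omega) fun i j => (hcomm i j).2)
  have hirr := isIrreducible_simultaneouslyDiagonalizable (F := F) (d := d) (n := n)
  refine ⟨⟨0, fun _ _ => Commute.zero_left _⟩, ?_⟩
  -- An open set meeting C(d,n) meets its dense irreducible subset, where two nonempty open parts
  -- intersect.
  rintro U V hU hV ⟨x, hx, hxU⟩ ⟨y, hy, hyV⟩
  have hxG := mem_closure_iff.1 (hsub hx) U hU hxU
  have hyG := mem_closure_iff.1 (hsub hy) V hV hyV
  rw [Set.inter_comm] at hxG hyG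
  exact (hirr.2 U V hU hV hxG hyG).mono
    (Set.inter_subset_inter_left _ simultaneouslyDiagonalizable_subset_commutingVariety)

end MatrixTuple

theorem mainTheorem8 (F : Type*) [Field F] [IsAlgClosed F] (d n : ℕ) :
    ((∀ m : ℕ, 0 < m → m < n → MatrixTuple.IsZariskiIrreducible (commutingVariety F d m)) →
      MatrixTuple.IsZariskiIrreducible (nilpotentCommutingVariety F d n) →
      MatrixTuple.IsZariskiIrreducible (commutingVariety F d n)) ∧
    ((∀ m : ℕ, 0 < m → m ≤ n →
        MatrixTuple.IsZariskiIrreducible (nilpotentCommutingVariety F d m)) →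
      MatrixTuple.IsZariskiIrreducible (commutingVariety F d n)) := by
  refine ⟨MatrixTuple.isIrreducible_commutingVariety, ?_⟩
  -- The induction supplies the irreducibility of the smaller C(d,m) required by part (1).
  induction n using Nat.strong_induction_on with
  | _ n ih =>
    intro hN
    rcases Nat.eq_zero_or_pos n with rfl | hn
    · exact MatrixTuple.isIrreducible_of_subsingleton
    · exact MatrixTuple.isIrreducible_commutingVariety
        (fun m _ hmn => ih m hmn fun k hk hkm => hN k hk (hkm.trans hmn.le))
        (hN n hn le_rfl)
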